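/- Let $n\ge 1$ and $k\ge 0$ be integers, let $\Delta^{n+1}=\{\lambda\in\mathbb R^{n+1}_+ : \sum_{j=1}^{n+1}\lambda_j=1\}$, and let $P^i=\{\lambda\in\Delta^{n+1} : \lambda_j\le 0\ \text{for all } j\notin\{i,i+1\}\}$ for $i=1,\dots,n$ (the SOS2 constraint on $\Delta^{n+1}$). Let $H=(h^i)_{i=1}^n$ be a family of pairwise distinct vectors $h^i\in\{0,1\}^k$, let $h^0=h^1$ and $h^{n+1}=h^n$, and let $$Q=\operatorname{conv}\Big(\bigcup_{i=1}^n P^i\times\{h^i\}\Big)\subseteq\mathbb R^{n+1}\times\mathbb R^k .$$ Let $L(H)=\operatorname{aff}(H)-h^1$ be the linear space parallel to $\operatorname{aff}(H)$, let $c^i=h^{i+1}-h^i$ for $i=1,\dots,n-1$, and for $b\in L(H)\setminus\{0\}$ let $M(b)=\{y\in L(H) : b\cdot y=0\}$. Let $b^1,\dots,b^N\in L(H)\setminus\{0\}$ be such that $\{M(b^l) : l=1,\dots,N\}$ is the set of all linear hyperplanes $M(b)$ of $L(H)$ that are the linear span of a (possibly empty) subfamily of $(c^i)_{i=1}^{n-1}$.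 Let $$J=\{1,n+1\}\cup\big\{j\in\{2,\dots,n\} : L(H)=\operatorname{span}\{c^i : 1\le i\le n-1,\ i\ne j-1\}\big\}.$$ Then $(\lambda,y)\in Q$ if and only if \begin{align*} \text{(a)}\quad & \sum_{j=1}^{n+1}\lambda_j=1,\qquad y\in\operatorname{aff}(H),\\ \text{(b)}\quad & \sum_{j=1}^{n+1}\min\{b^l\cdot h^j,\,b^l\cdot h^{j-1}\}\,\lambda_j\ \le\ b^l\cdot y\ \le\ \sum_{j=1}^{n+1}\max\{b^l\cdot h^j,\,b^l\cdot h^{j-1}\}\,\lambda_j\qquad\text{for } l=1,\dots,N,\\ \text{(c)}\quad & \lambda_j\ge 0\qquad\text{for all } j\in J. \end{align*} Furthermore, $\dim Q=n+\dim H$, where $\dim$ is the dimension of the affine hull; the affine hull of $Q$ is exactly the set of all $(\lambda,y)$ satisfying (a); and every inequality in (b) and (c) is facet defining for $Q$, that is, it is valid on $Q$ and the set of points of $Q$ satisfying it with equality is nonempty and has dimension $\dim Q-1$. Finally, none of the facets defined by the inequalities in (b) can be defined by a variable bound $\lambda_j\ge\beta$ or $\lambda_j\le\beta$ with $j\in\{1,\dots,n+1\}$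 and $\beta\in\mathbb R$. -/

import Mathlib

noncomputable section

namespace SOS2

open Matrix

/-- The (affine) dimension of a set, i.e. the dimension of its affine hull.
It is only used for nonempty sets. -/
def dim {V : Type*} [AddCommGroup V] [Module ℝ V] (S : Set V) : ℕ :=
  Module.finrank ℝ (affineSpan ℝ S).direction

/-- `IsEncoding h`: the `h i` are pairwise distinct vectors in `{0,1}^k`. -/
def IsEncoding {n k : ℕ} (h : Fin n → Fin k → ℝ) : Prop :=
  (∀ i t, h i t = 0 ∨ h i t = 1) ∧ ∀ i j, i ≠ j → h i ≠ h j

/-- The SOS2 constraint on the simplex in `ℝ^(n+1)`: the `i`-th polyhedron consists of the points of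
the simplex whose coordinates other than the `i`-th and the `(i+1)`-st are `≤ 0`. -/
def P {n : ℕ} (i : Fin n) : Set (Fin (n + 1) → ℝ) :=
  {lam | lam ∈ stdSimplex ℝ (Fin (n + 1)) ∧ ∀ j, j ≠ i.castSucc → j ≠ i.succ → lam j ≤ 0}

/-- The convex hull of the embedding `⋃ i, P i × {h i}`. -/
def Q {n k : ℕ} (P : Fin n → Set (Fin (n + 1) → ℝ)) (h : Fin n → Fin k → ℝ) :
    Set ((Fin (n + 1) → ℝ) × (Fin k → ℝ)) :=
  convexHull ℝ (⋃ i, P i ×ˢ {h i})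

/-- The encoding `h^1, …, h^n` numbered from `1` and extended by `h^0 = h^1`, `h^(n+1) = h^n`. -/
def hExt {n k : ℕ} [NeZero n] (h : Fin n → Fin k → ℝ) (i : ℕ) : Fin k → ℝ :=
  h ⟨min (i - 1) (n - 1), by have := Nat.pos_of_neZero n; omega⟩

/-- The differences of consecutive vectors of the encoding. -/
def c {n k : ℕ} (h : Fin n → Fin k → ℝ) (i : Fin (n - 1)) : Fin k → ℝ :=
  h ⟨i.val + 1, by omega⟩ - h ⟨i.val, by omega⟩

/-- The linear space parallel to the affine hull of the encoding. -/
def L {n k : ℕ} (h : Fin n → Fin k → ℝ) : Submodule ℝ (Fin k → ℝ) :=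
  (affineSpan ℝ (Set.range h)).direction

/-- The linear hyperplane of `L h` with normal vector `b`. -/
def M {n k : ℕ} (h : Fin n → Fin k → ℝ) (b : Fin k → ℝ) : Set (Fin k → ℝ) :=
  {y | y ∈ L h ∧ b ⬝ᵥ y = 0}

/-- The set of linear hyperplanes of `L h` that are spanned by some of the differences `c h i`. -/
def spannedHyperplanes {n k : ℕ} (h : Fin n → Fin k → ℝ) : Set (Set (Fin k → ℝ)) :=
  {S | (∃ b ∈ L h, b ≠ 0 ∧ S = M h b) ∧
    ∃ I : Set (Fin (n - 1)), S = (Submodule.span ℝ (c h '' I) : Set (Fin k → ℝ))}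

/-- The coordinates `j` (numbered here from `0` to `n`) that are the first one, the last one, or such
that `L h` is still spanned after the `j`-th difference, which is `c h (j - 1)`, is left out. -/
def J {n k : ℕ} (h : Fin n → Fin k → ℝ) : Set (Fin (n + 1)) :=
  {0, Fin.last n} ∪
    {j | j ≠ 0 ∧ j ≠ Fin.last n ∧
      L h = Submodule.span ℝ (c h '' {i : Fin (n - 1) | i.val + 1 ≠ j.val})}

/-- The coefficients `min {b · h^j, b · h^(j-1)}`, for `j = 1, …, n + 1`. -/
def minCoef {n k : ℕ} [NeZero n] (h : Fin n → Fin k → ℝ) (b : Fin k → ℝ) : Fin (n + 1) → ℝ :=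
  fun j => min (b ⬝ᵥ hExt h (j.val + 1)) (b ⬝ᵥ hExt h j.val)

/-- The coefficients `max {b · h^j, b · h^(j-1)}`, for `j = 1, …, n + 1`. -/
def maxCoef {n k : ℕ} [NeZero n] (h : Fin n → Fin k → ℝ) (b : Fin k → ℝ) : Fin (n + 1) → ℝ :=
  fun j => max (b ⬝ᵥ hExt h (j.val + 1)) (b ⬝ᵥ hExt h j.val)

/-- The points of `S` that satisfy the inequality `a · lam + d · y ≤ β` with equality. -/
def face {m k : ℕ} (S : Set ((Fin m → ℝ) × (Fin k → ℝ)))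
    (a : Fin m → ℝ) (d : Fin k → ℝ) (β : ℝ) : Set ((Fin m → ℝ) × (Fin k → ℝ)) :=
  {x | x ∈ S ∧ a ⬝ᵥ x.1 + d ⬝ᵥ x.2 = β}

/-- The inequality `a · lam + d · y ≤ β` is facet defining for `S`: it is valid on `S`, and the face
that it defines is nonempty and has dimension `dim S - 1`. -/
def IsFacetDefining {m k : ℕ} (S : Set ((Fin m → ℝ) × (Fin k → ℝ)))
    (a : Fin m → ℝ) (d : Fin k → ℝ) (β : ℝ) : Prop :=
  (∀ x ∈ S, a ⬝ᵥ x.1 + d ⬝ᵥ x.2 ≤ β) ∧ (face S a d β).Nonempty ∧ dim (face S a d β) + 1 = dim S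

end SOS2

end

/-! `Q` is the convex hull of the points `(e_j, h^(j-1))` and `(e_j, h^j)`. Splitting each weight
`lam j` between the two points above `e_j` shows that, for `lam` in the simplex, the fibre of `Q`
over `lam` is the zonotope `∑ lam j • [0, step j]` translated by `p = ∑ lam j • h^(j-1)`, where
`step j = h^j - h^(j-1)` (`mem_Q_of_coeff`). A zonotope is cut out by the functionals whose kernels
are spanned by generators (`exists_zonotope_coeff`). These normals do not depend on `lam`, and their
inequalities, translated back by `p`, are exactly (b).

For `j ∉ J` the steps other than `step j` span a hyperplane, and its two inequalities in (b) already
force `0 ≤ lam j` (`nonneg_of_notMem_J`).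

Dimensions are counted on vertices: a face containing both points above `e_j` has the direction `(0,
step j)`, and one vertex above each `e_j` gives the remaining directions
(`mem_vectorSpan_of_vertices`). -/

namespace SOS2
open Matrix

/-! ### Zonotopes and functionals whose kernels are spanned by generators. -/

section Separator

variable {ι V : Type*} [Fintype ι] [AddCommGroup V] [Module ℝ V]

/-- Moving a functional `d` in a direction `e` until the first of the signs of the values `d (v i)`
vanishes keeps `d y` above the support function of the zonotope generated by the `t i • v i`. -/
theorem exists_separator_of_direction (v : ι → V) (t : ι → ℝ) (y : V) (d e : Module.Dual ℝ V)
    (hd : ∑ i, t i * max (d (v i)) 0 < d y)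
    (he : ∀ i, d (v i) = 0 → e (v i) = 0)
    (hφ : ∑ i, t i * (if 0 < d (v i) then e (v i) else 0) ≤ e y)
    (hneg : ∃ i, e (v i) * d (v i) < 0) :
    ∃ d' : Module.Dual ℝ V, ∑ i, t i * max (d' (v i)) 0 < d' y ∧
      {i | d (v i) = 0} ⊂ {i | d' (v i) = 0} := by
  classical
  -- Among the indices where `e` opposes the sign of `d`, take the one whose value under `d + s • e`
  -- vanishes first.
  obtain ⟨i, hi, hmin⟩ := Finset.exists_min_image
    (Finset.univ.filter fun i => e (v i) * d (v i) < 0) (fun i => -(d (v i)) / e (v i))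
    (by obtain ⟨i, hi⟩ := hneg; exact ⟨i, by simpa using hi⟩)
  simp only [Finset.mem_filter, Finset.mem_univ, true_and] at hi hmin
  set s := -(d (v i)) / e (v i) with hs
  have hei : e (v i) ≠ 0 := by rintro h0; simp [h0] at hi
  have hdi : d (v i) ≠ 0 := by rintro h0; simp [h0] at hi
  have hspos : 0 < s := by
    have : s = -(e (v i) * d (v i)) / (e (v i)) ^ 2 := by rw [hs]; field_simp
    rw [this]
    have : 0 < (e (v i)) ^ 2 := by positivity
    apply div_pos <;> linarith
  have hzero : d (v i) + s * e (v i) = 0 := by rw [hs]; field_simp; ring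
  -- No sign has flipped at time `s`, so the support function is still linear along the move and
  -- `hφ` controls its growth.
  have hcell : ∀ j, 0 ≤ (d (v j) + s * e (v j)) * d (v j) := by
    intro j
    by_cases hj : e (v j) * d (v j) < 0
    · have h1 := hmin j hj
      have hej : e (v j) ≠ 0 := by rintro h0; simp [h0] at hj
      have h2 : -(d (v j)) / e (v j) * (e (v j) * d (v j)) = -(d (v j)) ^ 2 := by
        field_simp
      have h3 := mul_le_mul_of_nonpos_right h1 hj.le
      nlinarith
    · push Not at hj
      nlinarith [sq_nonneg (d (v j)), mul_nonneg hspos.le hj]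
  refine ⟨d + s • e, ?_, ?_⟩
  · have h1 : ∀ j, t j * max ((d + s • e) (v j)) 0 =
        t j * max (d (v j)) 0 + s * (t j * (if 0 < d (v j) then e (v j) else 0)) := by
      intro j
      have hc := hcell j
      simp only [LinearMap.add_apply, LinearMap.smul_apply, smul_eq_mul]
      rcases lt_trichotomy (d (v j)) 0 with h0 | h0 | h0
      · rw [if_neg h0.not_gt, max_eq_right h0.le, max_eq_right (nonpos_of_mul_nonneg_left hc h0)]
        ring
      · simp [h0, he j h0]
      · rw [if_pos h0, max_eq_left h0.le, max_eq_left (nonneg_of_mul_nonneg_left hc h0)]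
        ring
    rw [Finset.sum_congr rfl fun j _ => h1 j, Finset.sum_add_distrib, ← Finset.mul_sum]
    have := mul_le_mul_of_nonneg_left hφ hspos.le
    simp only [LinearMap.add_apply, LinearMap.smul_apply, smul_eq_mul]
    linarith
  · refine (Set.ssubset_iff_of_subset fun j hj => ?_).2 ⟨i, ?_, hdi⟩
    · simp only [Set.mem_ofPred_eq] at hj
      simp [hj, he j hj]
    · simpa using hzero

/-- If the kernel of `d` is too large, some `e` not proportional to `d` vanishes on all `v i` with
`d (v i) = 0`, and subtracting a multiple of `d` makes it vanish on a further `v i₀`. Moving `d`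
along `e` or `-e` yields a new zero, unless `e` itself already separates. -/
theorem exists_separator_zeroSet_ssubset (v : ι → V)
    (hv : Submodule.span ℝ (Set.range v) = ⊤) (t : ι → ℝ) (y : V) (d : Module.Dual ℝ V)
    (hd : ∑ i, t i * max (d (v i)) 0 < d y)
    (hker : LinearMap.ker d ≠ Submodule.span ℝ (v '' {i | d (v i) = 0})) :
    ∃ d' : Module.Dual ℝ V, ∑ i, t i * max (d' (v i)) 0 < d' y ∧
      {i | d (v i) = 0} ⊂ {i | d' (v i) = 0} := by
  have eq_zero : ∀ g : Module.Dual ℝ V, (∀ i, g (v i) = 0) → g = 0 := fun g hg =>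
    LinearMap.ext_on_range hv fun i => by simp [hg i]
  have hle : Submodule.span ℝ (v '' {i | d (v i) = 0}) ≤ LinearMap.ker d := by
    rw [Submodule.span_le]
    rintro _ ⟨i, hi, rfl⟩
    exact hi
  obtain ⟨m, hmd, hmW⟩ := SetLike.exists_of_lt (lt_of_le_of_ne hle hker.symm)
  obtain ⟨g, hgm, hgW⟩ := Submodule.exists_le_ker_of_notMem hmW
  obtain ⟨i₀, hi₀⟩ : ∃ i, d (v i) ≠ 0 := by
    by_contra! h0
    rw [eq_zero d h0] at hd
    simp at hd
  have hg0 : ∀ i, d (v i) = 0 → g (v i) = 0 := fun i hi =>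
    hgW (Submodule.subset_span ⟨i, hi, rfl⟩)
  obtain ⟨e, hem, hei₀, he, hφ⟩ : ∃ e : Module.Dual ℝ V, e m ≠ 0 ∧ e (v i₀) = 0 ∧
      (∀ i, d (v i) = 0 → e (v i) = 0) ∧
      ∑ i, t i * (if 0 < d (v i) then e (v i) else 0) ≤ e y := by
    let e₀ := g - (g (v i₀) / d (v i₀)) • d
    have h1 : e₀ m ≠ 0 := by simpa [e₀, LinearMap.mem_ker.1 hmd] using hgm
    have h2 : e₀ (v i₀) = 0 := by simp [e₀, hi₀]
    have h3 : ∀ i, d (v i) = 0 → e₀ (v i) = 0 := fun i hi => by simp [e₀, hi, hg0 i hi]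
    rcases le_total (∑ i, t i * (if 0 < d (v i) then e₀ (v i) else 0)) (e₀ y) with h | h
    · exact ⟨e₀, h1, h2, h3, h⟩
    -- The condition is linear in the direction, so one of `e₀` and `-e₀` satisfies it.
    · refine ⟨-e₀, by simpa using h1, by simpa using h2, fun i hi => by simpa using h3 i hi, ?_⟩
      have h4 : ∀ i, t i * (if 0 < d (v i) then (-e₀) (v i) else 0) =
          -(t i * (if 0 < d (v i) then e₀ (v i) else 0)) := fun i => by split_ifs <;> simp
      rw [Finset.sum_congr rfl fun i _ => h4 i, Finset.sum_neg_distrib]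
      simpa using h
  by_cases hneg : ∃ i, e (v i) * d (v i) < 0
  · exact exists_separator_of_direction v t y d e hd he hφ hneg
  push Not at hneg
  -- Now `e` never opposes `d`, so the left side of `hφ` is the support function at `e`. Strict
  -- inequality makes `e` a separator; under equality `-e` is also admissible, and it opposes `d`
  -- somewhere because `e ≠ 0`.
  rcases hφ.lt_or_eq with hlt | heq
  · refine ⟨e, ?_, ?_⟩
    · refine lt_of_eq_of_lt (Finset.sum_congr rfl fun i _ => congrArg (t i * ·) ?_) hlt
      rcases lt_trichotomy (d (v i)) 0 with h0 | h0 | h0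
      · rw [if_neg h0.not_gt, max_eq_right (nonpos_of_mul_nonneg_left (hneg i) h0)]
      · simp [h0, he i h0]
      · rw [if_pos h0, max_eq_left (nonneg_of_mul_nonneg_left (hneg i) h0)]
    · exact (Set.ssubset_iff_of_subset fun j hj => he j hj).2 ⟨i₀, hei₀, hi₀⟩
  · refine exists_separator_of_direction v t y d (-e) hd (fun i hi => by simp [he i hi]) ?_ ?_
    · have h4 : ∀ i, t i * (if 0 < d (v i) then (-e) (v i) else 0) =
          -(t i * (if 0 < d (v i) then e (v i) else 0)) := fun i => by split_ifs <;> simp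
      rw [Finset.sum_congr rfl fun i _ => h4 i, Finset.sum_neg_distrib]
      rw [heq, LinearMap.neg_apply]
    · obtain ⟨i, hi⟩ : ∃ i, e (v i) ≠ 0 := by
        by_contra! h0
        exact hem (by simp [eq_zero e h0])
      refine ⟨i, ?_⟩
      have h5 : e (v i) * d (v i) ≠ 0 := mul_ne_zero hi fun h0 => hi (he i h0)
      have := lt_of_le_of_ne (hneg i) h5.symm
      simpa using this

/-- A point that is separated from the zonotope generated by the `t i • v i` is also separated by a
functional whose kernel is spanned by some of the `v i`. -/
theorem exists_separator_ker_eq_span (v : ι → V)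
    (hv : Submodule.span ℝ (Set.range v) = ⊤) (t : ι → ℝ) (y : V)
    (hsep : ∃ d : Module.Dual ℝ V, ∑ i, t i * max (d (v i)) 0 < d y) :
    ∃ d : Module.Dual ℝ V, ∑ i, t i * max (d (v i)) 0 < d y ∧
      LinearMap.ker d = Submodule.span ℝ (v '' {i | d (v i) = 0}) := by
  obtain ⟨d, hd⟩ := hsep
  suffices H : ∀ (Z : Set ι) (d : Module.Dual ℝ V), {i | d (v i) = 0} = Z →
      ∑ i, t i * max (d (v i)) 0 < d y → ∃ d : Module.Dual ℝ V,
      ∑ i, t i * max (d (v i)) 0 < d y ∧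
        LinearMap.ker d = Submodule.span ℝ (v '' {i | d (v i) = 0}) from H _ d rfl hd
  intro Z
  induction Z using WellFoundedGT.induction with
  | ind Z ih =>
    rintro d rfl hd
    by_cases hker : LinearMap.ker d = Submodule.span ℝ (v '' {i | d (v i) = 0})
    · exact ⟨d, hd, hker⟩
    · obtain ⟨d', hd', hlt⟩ := exists_separator_zeroSet_ssubset v hv t y d hd hker
      exact ih _ hlt d' rfl hd'

end Separator

/-- The description of a zonotope by functionals whose kernels are spanned by generators. -/
theorem exists_zonotope_coeff {ι V : Type*} [Fintype ι] [NormedAddCommGroup V] [NormedSpace ℝ V]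
    (v : ι → V) (hv : Submodule.span ℝ (Set.range v) = ⊤) (t : ι → ℝ) (ht : ∀ i, 0 ≤ t i) (y : V)
    (hy : ∀ d : Module.Dual ℝ V, LinearMap.ker d = Submodule.span ℝ (v '' {i | d (v i) = 0}) →
      d y ≤ ∑ i, t i * max (d (v i)) 0) :
    ∃ s : ι → ℝ, (∀ i, 0 ≤ s i) ∧ (∀ i, s i ≤ t i) ∧ ∑ i, s i • v i = y := by
  by_contra hcon
  let T : (ι → ℝ) →ₗ[ℝ] V := Fintype.linearCombination ℝ v
  have hT : Continuous T := LinearMap.continuous_of_finiteDimensional T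
  have hcomp : IsCompact (T '' Set.Icc 0 t) := isCompact_Icc.image hT
  have hconv : Convex ℝ (T '' Set.Icc 0 t) := (convex_Icc 0 t).linear_image T
  have hyT : y ∉ T '' Set.Icc 0 t := by
    rintro ⟨s, hs, rfl⟩
    exact hcon ⟨s, fun i => hs.1 i, fun i => hs.2 i, by simp [T, Fintype.linearCombination_apply]⟩
  obtain ⟨f, u, hfu, huy⟩ := geometric_hahn_banach_closed_point hconv hcomp.isClosed hyT
  obtain ⟨d, hd, hker⟩ := exists_separator_ker_eq_span v hv t y ⟨f.toLinearMap, by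
    -- This point of the box maximizes `f ∘ T`, so its value is the support function at `f`.
    refine lt_of_eq_of_lt ?_ ((hfu (T fun i => if 0 < f (v i) then t i else 0)
      ⟨_, ⟨fun i => ?_, fun i => ?_⟩, rfl⟩).trans huy)
    · simp only [T, Fintype.linearCombination_apply, map_sum, map_smul, smul_eq_mul]
      refine Finset.sum_congr rfl fun i _ => ?_
      split_ifs with h0
      · simp [max_eq_left h0.le]
      · simp [max_eq_right (not_lt.1 h0)]
    · dsimp only; split_ifs
      exacts [ht i, le_rfl]
    · dsimp only; split_ifs
      exacts [le_rfl, ht i]⟩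
  exact (hy d hker).not_gt hd

/-- A functional on a subspace of `ℝ^k` is the dot product with a vector of the subspace. -/
theorem exists_dotProduct_eq {k : ℕ} (W : Submodule ℝ (Fin k → ℝ)) (g : Module.Dual ℝ W) :
    ∃ b ∈ W, ∀ y : W, g y = b ⬝ᵥ (y : Fin k → ℝ) := by
  let T : W →ₗ[ℝ] Module.Dual ℝ W :=
    LinearMap.mk₂ ℝ (fun x y : W => (x : Fin k → ℝ) ⬝ᵥ (y : Fin k → ℝ))
      (by intros; simp [add_dotProduct]) (by intros; simp)
      (by intros; simp [dotProduct_add]) (by intros; simp)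
  have hinj : Function.Injective T := by
    rw [injective_iff_map_eq_zero]
    intro x hx
    have : T x x = 0 := by simp [hx]
    exact Subtype.ext (dotProduct_self_eq_zero.1 this)
  obtain ⟨b, hb⟩ := (LinearMap.injective_iff_surjective_of_finrank_eq_finrank
    (Subspace.dual_finrank_eq (K := ℝ) (V := W)).symm).1 hinj g
  exact ⟨b, b.2, fun y => by rw [← hb]; rfl⟩

end SOS2

namespace SOS2
open Matrix

variable {n k : ℕ}

theorem sub_mem_L (h : Fin n → Fin k → ℝ) (i j : Fin n) : h i - h j ∈ L h := by
  rw [L, direction_affineSpan]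
  exact vsub_mem_vectorSpan ℝ ⟨i, rfl⟩ ⟨j, rfl⟩

theorem exists_val_eq (j : Fin (n + 1)) (h0 : j ≠ 0) (hl : j ≠ Fin.last n) :
    ∃ i : Fin (n - 1), i.val + 1 = j.val := by
  have h1 : j.val ≠ 0 := fun h => h0 (Fin.ext h)
  have h2 : j.val ≠ n := fun h => hl (Fin.ext h)
  have := j.2
  exact ⟨⟨j.val - 1, by omega⟩, by simp only; omega⟩

/-! ### Consecutive differences of the extended encoding. -/

section Encoding

variable [NeZero n] (h : Fin n → Fin k → ℝ)

/-- The differences of consecutive vectors of the extended encoding. -/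
def step (j : Fin (n + 1)) : Fin k → ℝ :=
  hExt h (j.val + 1) - hExt h j.val

/-- The shift by one arises because `hExt` numbers the encoding from `1` and `c` from `0`. -/
theorem step_of_val_eq (i : Fin (n - 1)) (j : Fin (n + 1)) (hij : i.val + 1 = j.val) :
    step h j = c h i := by
  have := i.2
  simp only [step, hExt, c]
  congr 3 <;> omega

theorem step_eq_zero (j : Fin (n + 1)) (hj : j = 0 ∨ j = Fin.last n) : step h j = 0 := by
  have := Nat.pos_of_neZero n
  rw [step, sub_eq_zero]
  simp only [hExt]
  rcases hj with rfl | rfl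
  · simp
  · congr 2
    simp

/-- The two extra steps, at the ends, are zero and contribute nothing. This translates between
hyperplanes spanned by differences `c` and zonotopes generated by steps. -/
theorem span_step_image (A : Set (Fin (n + 1))) :
    Submodule.span ℝ (step h '' A) =
      Submodule.span ℝ (c h '' {i : Fin (n - 1) | ∃ j ∈ A, i.val + 1 = j.val}) := by
  apply le_antisymm <;> rw [Submodule.span_le]
  · rintro _ ⟨j, hj, rfl⟩
    by_cases h0 : j = 0 ∨ j = Fin.last n
    · rw [step_eq_zero h j h0]
      exact zero_mem _
    · push Not at h0
      obtain ⟨i, hi⟩ := exists_val_eq j h0.1 h0.2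
      rw [step_of_val_eq h i j hi]
      exact Submodule.subset_span ⟨i, ⟨j, hj, hi⟩, rfl⟩
  · rintro _ ⟨i, ⟨j, hj, hi⟩, rfl⟩
    rw [← step_of_val_eq h i j hi]
    exact Submodule.subset_span ⟨j, hj, rfl⟩

theorem L_eq_span_c : L h = Submodule.span ℝ (Set.range (c h)) := by
  have hn := Nat.pos_of_neZero n
  apply le_antisymm
  · rw [L, direction_affineSpan, vectorSpan_range_eq_span_range_vsub_right ℝ h ⟨0, hn⟩,
      Submodule.span_le]
    rintro _ ⟨⟨i, hi⟩, rfl⟩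
    -- Telescoping from the first vector.
    induction i with
    | zero => simp
    | succ i ih =>
      have h1 := ih (by omega)
      have h2 : c h ⟨i, by omega⟩ ∈ Submodule.span ℝ (Set.range (c h)) :=
        Submodule.subset_span ⟨_, rfl⟩
      have h3 := add_mem h1 h2
      simpa [c] using h3
  · rw [Submodule.span_le]
    rintro _ ⟨i, rfl⟩
    exact sub_mem_L h _ _

theorem span_step : Submodule.span ℝ (Set.range (step h)) = L h := by
  rw [← Set.image_univ, span_step_image, L_eq_span_c, ← Set.image_univ]
  congr 2
  ext i
  simp only [Set.mem_univ, true_and, iff_true]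
  exact ⟨⟨i.val + 1, by omega⟩, rfl⟩

theorem step_mem_L (j : Fin (n + 1)) : step h j ∈ L h := sub_mem_L h _ _

theorem step_image_span_le (A : Set (Fin (n + 1))) :
    Submodule.span ℝ (step h '' A) ≤ L h := by
  rw [← span_step]
  exact Submodule.span_mono (Set.image_subset_range _ _)

end Encoding

/-! ### Vertices of `Q` and valid inequalities. -/

section Vertices

variable (h : Fin n → Fin k → ℝ)

theorem single_mem_Q (i : Fin n) (j : Fin (n + 1)) (hj : j = i.castSucc ∨ j = i.succ) :
    ((Pi.single j 1 : Fin (n + 1) → ℝ), h i) ∈ Q P h := by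
  refine subset_convexHull ℝ _ (Set.mem_iUnion.2 ⟨i, ⟨single_mem_stdSimplex ℝ j, ?_⟩, rfl⟩)
  intro j' h1 h2
  have : j' ≠ j := by rintro rfl; exact hj.elim h1 h2
  simp [this]

theorem Q_subset {C : Set ((Fin (n + 1) → ℝ) × (Fin k → ℝ))} (hC : Convex ℝ C)
    (hP : ∀ i, ∀ lam ∈ P i, (lam, h i) ∈ C) : Q P h ⊆ C := by
  refine convexHull_min (Set.iUnion_subset fun i => ?_) hC
  rintro ⟨lam, y⟩ ⟨h1, h2⟩
  obtain rfl : y = h i := h2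
  exact hP i lam h1

theorem nonneg_of_mem_Q {x : (Fin (n + 1) → ℝ) × (Fin k → ℝ)} (hx : x ∈ Q P h)
    (j : Fin (n + 1)) : 0 ≤ x.1 j := by
  let φ : ((Fin (n + 1) → ℝ) × (Fin k → ℝ)) →ₗ[ℝ] ℝ := LinearMap.proj j ∘ₗ LinearMap.fst ℝ _ _
  exact Q_subset (C := {x | 0 ≤ φ x}) h (convex_halfSpace_ge φ.isLinear 0)
    (fun i lam hl => hl.1.1 j) hx

theorem sum_eq_one_of_mem_Q {x : (Fin (n + 1) → ℝ) × (Fin k → ℝ)} (hx : x ∈ Q P h) :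
    ∑ j, x.1 j = 1 := by
  let φ : ((Fin (n + 1) → ℝ) × (Fin k → ℝ)) →ₗ[ℝ] ℝ :=
    ∑ j, LinearMap.proj j ∘ₗ LinearMap.fst ℝ _ _
  have := Q_subset (C := {x | φ x = 1}) h (convex_hyperplane φ.isLinear 1)
    (fun i lam hl => by simpa [φ] using hl.1.2) hx
  simpa [φ] using this

theorem snd_mem_of_mem_Q {x : (Fin (n + 1) → ℝ) × (Fin k → ℝ)} (hx : x ∈ Q P h) :
    x.2 ∈ affineSpan ℝ (Set.range h) :=
  Q_subset (C := LinearMap.snd ℝ (Fin (n + 1) → ℝ) _ ⁻¹' (affineSpan ℝ (Set.range h)))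
    h ((affineSpan ℝ (Set.range h)).convex.linear_preimage _)
    (fun i _ _ => mem_affineSpan ℝ ⟨i, rfl⟩) hx

variable [NeZero n]

theorem single_hExt_mem_Q (j : Fin (n + 1)) :
    ((Pi.single j 1 : Fin (n + 1) → ℝ), hExt h j.val) ∈ Q P h := by
  have hn := Nat.pos_of_neZero n
  -- The index is `i = min (j - 1) (n - 1)`, so `j = i + 1`, except that truncation gives `i = 0` at
  -- `j = 0`.
  apply single_mem_Q
  simp only [Fin.ext_iff, Fin.val_castSucc, Fin.val_succ]
  omega

theorem single_hExt_succ_mem_Q (j : Fin (n + 1)) :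
    ((Pi.single j 1 : Fin (n + 1) → ℝ), hExt h (j.val + 1)) ∈ Q P h := by
  have hn := Nat.pos_of_neZero n
  apply single_mem_Q
  simp only [Fin.ext_iff, Fin.val_castSucc, Fin.val_succ]
  omega

theorem eq_hExt (i : Fin n) (j : Fin (n + 1)) (hj : j = i.castSucc ∨ j = i.succ) :
    h i = hExt h (j.val + 1) ∨ h i = hExt h j.val := by
  have := i.2
  rcases hj with rfl | rfl
  · left
    simp only [hExt, Fin.val_castSucc]
    congr 1
    ext
    simp only
    omega
  · right
    simp only [hExt, Fin.val_succ]
    congr 1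
    ext
    simp only
    omega

/-- On `P i` only the coordinates `i` and `i + 1` survive, and for both of them `b · h i` is one of
the two terms of the maximum. -/
theorem maxCoef_valid {x : (Fin (n + 1) → ℝ) × (Fin k → ℝ)} (b : Fin k → ℝ) (hx : x ∈ Q P h) :
    b ⬝ᵥ x.2 ≤ ∑ j, maxCoef h b j * x.1 j := by
  let φ : ((Fin (n + 1) → ℝ) × (Fin k → ℝ)) →ₗ[ℝ] ℝ :=
    dotProductBilin ℝ ℝ b ∘ₗ LinearMap.snd ℝ _ _ -
      dotProductBilin ℝ ℝ (maxCoef h b) ∘ₗ LinearMap.fst ℝ _ _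
  have := Q_subset (C := {x | φ x ≤ 0}) h (convex_halfSpace_le φ.isLinear 0) ?_ hx
  · have h1 : b ⬝ᵥ x.2 - maxCoef h b ⬝ᵥ x.1 ≤ 0 := this
    exact sub_nonpos.1 h1
  · intro i lam hl
    change b ⬝ᵥ h i - maxCoef h b ⬝ᵥ lam ≤ 0
    rw [sub_nonpos]
    calc b ⬝ᵥ h i = ∑ j, b ⬝ᵥ h i * lam j := by rw [← Finset.mul_sum, hl.1.2, mul_one]
      _ ≤ _ := Finset.sum_le_sum fun j _ => ?_
    by_cases hj : j = i.castSucc ∨ j = i.succ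
    · refine mul_le_mul_of_nonneg_right ?_ (hl.1.1 j)
      rcases eq_hExt h i j hj with h1 | h1 <;> rw [h1]
      · exact le_max_left _ _
      · exact le_max_right _ _
    · push Not at hj
      have : lam j = 0 := le_antisymm (hl.2 j hj.1 hj.2) (hl.1.1 j)
      simp [this]

/-- Negating `b` exchanges the two sides of (b), so results on the lower side follow from those on
the upper side. -/
theorem maxCoef_neg (b : Fin k → ℝ) : maxCoef h (-b) = -minCoef h b := by
  ext j
  simp only [maxCoef, minCoef, neg_dotProduct, Pi.neg_apply]
  exact max_neg_neg _ _

theorem minCoef_valid {x : (Fin (n + 1) → ℝ) × (Fin k → ℝ)} (b : Fin k → ℝ) (hx : x ∈ Q P h) :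
    ∑ j, minCoef h b j * x.1 j ≤ b ⬝ᵥ x.2 := by
  have := maxCoef_valid h (-b) hx
  rw [maxCoef_neg] at this
  simpa using this

/-- Subtracting the base point turns the upper bound of (b) into the support function of the
zonotope. -/
theorem maxCoef_sub (b : Fin k → ℝ) (j : Fin (n + 1)) :
    maxCoef h b j - b ⬝ᵥ hExt h j.val = max (b ⬝ᵥ step h j) 0 := by
  rw [maxCoef, step, dotProduct_sub, ← max_sub_sub_right, sub_self]

/-- A convex combination of the vertices, with weight `lam j - s j` on `hExt h j` and `s j` on
`hExt h (j + 1)`. -/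
theorem mem_Q_of_coeff (lam s : Fin (n + 1) → ℝ) (hsum : ∑ j, lam j = 1) (hs0 : ∀ j, 0 ≤ s j)
    (hs1 : ∀ j, s j ≤ lam j) :
    (lam, ∑ j, lam j • hExt h j.val + ∑ j, s j • step h j) ∈ Q P h := by
  have hconv : Convex ℝ (Q P h) := convex_convexHull ℝ _
  let p : Fin (n + 1) ⊕ Fin (n + 1) → (Fin (n + 1) → ℝ) × (Fin k → ℝ) :=
    Sum.elim (fun j => (Pi.single j 1, hExt h j.val)) (fun j => (Pi.single j 1, hExt h (j.val + 1)))
  let w : Fin (n + 1) ⊕ Fin (n + 1) → ℝ := Sum.elim (fun j => lam j - s j) s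
  have hmem := hconv.sum_mem (t := Finset.univ) (w := w) (z := p) ?_ ?_ ?_
  · convert hmem using 1
    rw [Fintype.sum_sum_type]
    simp only [w, p, Sum.elim_inl, Sum.elim_inr, Prod.smul_mk, ← Finset.sum_add_distrib,
      Prod.mk_add_mk, ← add_smul, sub_add_cancel]
    refine Prod.ext ?_ ?_
    · simp only [Prod.fst_sum]
      ext j
      simp [Finset.sum_apply, Pi.single_apply]
    · simp only [Prod.snd_sum]
      refine Finset.sum_congr rfl fun j _ => ?_
      simp only [step, smul_sub, sub_smul]
      abel
  · rintro (j | j) _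
    · exact sub_nonneg.2 (hs1 j)
    · exact hs0 j
  · rw [Fintype.sum_sum_type]
    simp only [w, Sum.elim_inl, Sum.elim_inr, ← Finset.sum_add_distrib, sub_add_cancel, hsum]
  · rintro (j | j) _
    · exact single_hExt_mem_Q h j
    · exact single_hExt_succ_mem_Q h j

end Vertices

end SOS2

/-! ### Affine hull, dimension and facets. -/

namespace SOS2
open Matrix

variable {n k : ℕ}

/-- Differences of the chosen vertices realize the first component because its coordinates sum to
zero; what is left is vertical and lies in `W`. Used for `Q` and for both kinds of facets. -/
theorem mem_vectorSpan_of_vertices {m : ℕ} {T : Set ((Fin m → ℝ) × (Fin k → ℝ))}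
    (w : Fin m → Fin k → ℝ) (W : Submodule ℝ (Fin k → ℝ)) (A : Set (Fin m))
    (hA : A.Nonempty) (hT : ∀ j ∈ A, (Pi.single j 1, w j) ∈ T)
    (hW : ∀ z ∈ W, (0, z) ∈ vectorSpan ℝ T) {x : (Fin m → ℝ) × (Fin k → ℝ)}
    (hsum : ∑ j, x.1 j = 0) (hxA : ∀ j ∉ A, x.1 j = 0) (hx : x.2 - ∑ j, x.1 j • w j ∈ W) :
    x ∈ vectorSpan ℝ T := by
  obtain ⟨j₀, hj₀⟩ := hA
  let p : Fin m → (Fin m → ℝ) × (Fin k → ℝ) := fun j => (Pi.single j 1, w j)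
  have h1 : ∑ j, x.1 j • (p j - p j₀) ∈ vectorSpan ℝ T := by
    refine sum_mem fun j _ => ?_
    by_cases hj : j ∈ A
    · exact Submodule.smul_mem _ _ (vsub_mem_vectorSpan ℝ (hT j hj) (hT j₀ hj₀))
    · simp [hxA j hj]
  have h2 : x = ∑ j, x.1 j • (p j - p j₀) + (0, x.2 - ∑ j, x.1 j • w j) := by
    simp only [smul_sub, Finset.sum_sub_distrib, ← Finset.sum_smul, hsum, zero_smul, sub_zero]
    refine Prod.ext ?_ ?_
    · ext j
      simp [p, Prod.fst_sum, Finset.sum_apply, Pi.single_apply]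
    · simp [p, Prod.snd_sum]
  rw [h2]
  exact add_mem h1 (hW _ hx)

theorem finrank_submodule_prod {V W : Type*} [AddCommGroup V] [Module ℝ V] [AddCommGroup W]
    [Module ℝ W] [FiniteDimensional ℝ V] [FiniteDimensional ℝ W] (p : Submodule ℝ V)
    (q : Submodule ℝ W) :
    Module.finrank ℝ (p.prod q) = Module.finrank ℝ p + Module.finrank ℝ q := by
  have h1 : p.prod q = LinearMap.range (p.subtype.prodMap q.subtype) := by
    rw [LinearMap.range_prodMap, Submodule.range_subtype, Submodule.range_subtype]
  rw [h1, LinearMap.finrank_range_of_inj, Module.finrank_prod]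
  exact Function.Injective.prodMap p.injective_subtype q.injective_subtype

theorem dim_eq {V : Type*} [AddCommGroup V] [Module ℝ V] (S : Set V) :
    dim S = Module.finrank ℝ (vectorSpan ℝ S) := by
  rw [dim, direction_affineSpan]

theorem finrank_inf_ker_add_one {V : Type*} [AddCommGroup V] [Module ℝ V] [FiniteDimensional ℝ V]
    (D : Submodule ℝ V) (φ : Module.Dual ℝ V) (hφ : ∃ x ∈ D, φ x ≠ 0) :
    Module.finrank ℝ (D ⊓ LinearMap.ker φ : Submodule ℝ V) + 1 = Module.finrank ℝ D := by
  have hne : φ.domRestrict D ≠ 0 := by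
    obtain ⟨x, hx, hx0⟩ := hφ
    intro h0
    exact hx0 (LinearMap.congr_fun h0 ⟨x, hx⟩)
  rw [← Module.Dual.finrank_ker_add_one_of_ne_zero hne]
  congr 1
  have h1 : D ⊓ LinearMap.ker φ = (LinearMap.ker (φ.domRestrict D)).map D.subtype := by
    ext x
    simp [and_comm]
  rw [h1]
  exact Submodule.finrank_map_subtype_eq _ _
/-- A hyperplane section of `S` has codimension one if its directions are all the directions of `S`
along the hyperplane. -/
theorem dim_section_add_one {V : Type*} [AddCommGroup V] [Module ℝ V] [FiniteDimensional ℝ V]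
    (S : Set V) (φ : Module.Dual ℝ V) (β : ℝ) (hφ : ∃ x ∈ vectorSpan ℝ S, φ x ≠ 0)
    (hS : ∀ x ∈ vectorSpan ℝ S, φ x = 0 → x ∈ vectorSpan ℝ {x | x ∈ S ∧ φ x = β}) :
    dim {x | x ∈ S ∧ φ x = β} + 1 = dim S := by
  have : vectorSpan ℝ {x | x ∈ S ∧ φ x = β} = vectorSpan ℝ S ⊓ LinearMap.ker φ := by
    refine le_antisymm (le_inf (vectorSpan_mono ℝ fun x hx => hx.1) ?_) fun x hx => hS x hx.1 hx.2
    rw [vectorSpan_def, Submodule.span_le]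
    rintro _ ⟨x, hx, y, hy, rfl⟩
    simp [hx.2, hy.2]
  rw [dim_eq, dim_eq, ← finrank_inf_ker_add_one _ φ hφ, this]

theorem single_mem_J_face (h : Fin n → Fin k → ℝ) (j i : Fin (n + 1)) (hij : i ≠ j) (y : Fin k → ℝ)
    (hy : (Pi.single i 1, y) ∈ Q P h) :
    (Pi.single i 1, y) ∈ face (Q P h) (-Pi.single j 1) 0 0 := by
  refine ⟨hy, ?_⟩
  simp [hij.symm]

theorem M_neg (h : Fin n → Fin k → ℝ) (b : Fin k → ℝ) : M h (-b) = M h b := by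
  ext y
  simp [M]

variable [NeZero n] (h : Fin n → Fin k → ℝ)

/-- The two vertices above `e_j` differ by `(0, step h j)`. -/
theorem zero_prod_mem_vectorSpan {T : Set ((Fin (n + 1) → ℝ) × (Fin k → ℝ))}
    (A : Set (Fin (n + 1))) (hT : ∀ j ∈ A, (Pi.single j 1, hExt h j.val) ∈ T)
    (hT' : ∀ j ∈ A, (Pi.single j 1, hExt h (j.val + 1)) ∈ T) :
    ∀ z ∈ Submodule.span ℝ (step h '' A),
      ((0, z) : (Fin (n + 1) → ℝ) × (Fin k → ℝ)) ∈ vectorSpan ℝ T := by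
  suffices H : Submodule.span ℝ (step h '' A) ≤
      (vectorSpan ℝ T).comap (LinearMap.inr ℝ (Fin (n + 1) → ℝ) (Fin k → ℝ)) from fun z hz => H hz
  rw [Submodule.span_le]
  rintro _ ⟨j, hj, rfl⟩
  have := vsub_mem_vectorSpan ℝ (hT' j hj) (hT j hj)
  simpa [step] using this

theorem sum_smul_hExt_mem_L (w : Fin (n + 1) → Fin k → ℝ) (hw : ∀ j, w j ∈ Set.range h)
    (mu : Fin (n + 1) → ℝ) (hmu : ∑ j, mu j = 0) : ∑ j, mu j • w j ∈ L h := by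
  have h1 : ∑ j, mu j • w j = ∑ j, mu j • (w j - h 0) := by
    simp only [smul_sub, Finset.sum_sub_distrib, ← Finset.sum_smul, hmu, zero_smul, sub_zero]
  rw [h1]
  refine sum_mem fun j _ => Submodule.smul_mem _ _ ?_
  obtain ⟨i, hi⟩ := hw j
  rw [← hi]
  exact sub_mem_L h _ _

theorem mem_vectorSpan_Q (x : (Fin (n + 1) → ℝ) × (Fin k → ℝ)) :
    x ∈ vectorSpan ℝ (Q P h) ↔ ∑ j, x.1 j = 0 ∧ x.2 ∈ L h := by
  constructor
  · let S : (Fin (n + 1) → ℝ) →ₗ[ℝ] ℝ := ∑ j, LinearMap.proj j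
    suffices H : vectorSpan ℝ (Q P h) ≤ (LinearMap.ker S).prod (L h) by
      intro hx
      have := H hx
      simpa [S] using this
    rw [vectorSpan_def, Submodule.span_le]
    rintro _ ⟨x, hx, y, hy, rfl⟩
    refine ⟨?_, ?_⟩
    · simp [S, sum_eq_one_of_mem_Q h hx, sum_eq_one_of_mem_Q h hy]
    · exact AffineSubspace.vsub_mem_direction (snd_mem_of_mem_Q h hx) (snd_mem_of_mem_Q h hy)
  · rintro ⟨h1, h2⟩
    refine mem_vectorSpan_of_vertices (fun j => hExt h j.val) (L h) Set.univ Set.univ_nonempty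
      (fun j _ => single_hExt_mem_Q h j) ?_ h1 (by simp) ?_
    · rw [← span_step, ← Set.image_univ]
      exact zero_prod_mem_vectorSpan h _ (fun j _ => single_hExt_mem_Q h j)
        (fun j _ => single_hExt_succ_mem_Q h j)
    · exact sub_mem h2 (sum_smul_hExt_mem_L h _ (fun j => ⟨_, rfl⟩) _ h1)

theorem dim_Q : dim (Q P h) = n + dim (Set.range h) := by
  let S : (Fin (n + 1) → ℝ) →ₗ[ℝ] ℝ := ∑ j, LinearMap.proj j
  have h1 : vectorSpan ℝ (Q P h) = (LinearMap.ker S).prod (L h) := by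
    ext x
    rw [mem_vectorSpan_Q]
    simp [S]
  have h2 : S ≠ 0 := fun h0 => by
    have : S (Pi.single 0 1) = 0 := by rw [h0]; rfl
    simp [S] at this
  have h3 := Module.Dual.finrank_ker_add_one_of_ne_zero h2
  rw [Module.finrank_fin_fun] at h3
  rw [dim_eq, h1, finrank_submodule_prod, dim, ← L]
  omega

theorem mem_affineSpan_Q (lam : Fin (n + 1) → ℝ) (y : Fin k → ℝ) :
    (lam, y) ∈ affineSpan ℝ (Q P h) ↔ ∑ j, lam j = 1 ∧ y ∈ affineSpan ℝ (Set.range h) := by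
  rw [← AffineSubspace.vsub_right_mem_direction_iff_mem
      (mem_affineSpan ℝ (single_hExt_mem_Q h 0)), direction_affineSpan, mem_vectorSpan_Q,
    ← AffineSubspace.vsub_right_mem_direction_iff_mem (s := affineSpan ℝ (Set.range h))
      (mem_affineSpan ℝ (⟨_, rfl⟩ : hExt h 0 ∈ Set.range h))]
  refine and_congr ?_ Iff.rfl
  simp [sub_eq_zero]

theorem span_step_compl (j : Fin (n + 1)) :
    Submodule.span ℝ (step h '' {j}ᶜ) =
      Submodule.span ℝ (c h '' {i : Fin (n - 1) | i.val + 1 ≠ j.val}) := by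
  rw [span_step_image]
  congr 2
  ext i
  have := i.2
  constructor
  · rintro ⟨j', h1, h2⟩ h3
    exact h1 (Fin.ext (h2.symm.trans h3))
  · intro h1
    exact ⟨⟨i.val + 1, by omega⟩, fun h2 => h1 (by rw [← Set.mem_singleton_iff.1 h2]), rfl⟩

theorem span_step_compl_of_mem_J (j : Fin (n + 1)) (hj : j ∈ J h) :
    Submodule.span ℝ (step h '' {j}ᶜ) = L h := by
  rcases hj with hj | ⟨-, -, hj⟩
  · refine le_antisymm (step_image_span_le h _) ?_
    rw [← span_step, Submodule.span_le]
    rintro _ ⟨i, rfl⟩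
    by_cases hi : i = j
    · rw [hi, step_eq_zero h j hj]
      exact zero_mem _
    · exact Submodule.subset_span ⟨i, hi, rfl⟩
  · rw [span_step_compl, hj]

/-- The face contains both vertices above every `e_i` with `i ≠ j`, and `j ∈ J` says that the
corresponding steps still span `L h`. -/
theorem isFacetDefining_of_mem_J (j : Fin (n + 1)) (hj : j ∈ J h) :
    IsFacetDefining (Q P h) (-Pi.single j 1) 0 0 := by
  obtain ⟨i₀, hi₀⟩ : ∃ i : Fin (n + 1), i ≠ j := by
    have := Nat.pos_of_neZero n
    have : Nontrivial (Fin (n + 1)) := Fin.nontrivial_iff_two_le.2 (by omega)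
    exact exists_ne j
  refine ⟨fun x hx => ?_, ⟨_, single_mem_J_face h j i₀ hi₀ _ (single_hExt_mem_Q h i₀)⟩, ?_⟩
  · have := nonneg_of_mem_Q h hx j
    simpa using this
  · let φ : Module.Dual ℝ ((Fin (n + 1) → ℝ) × (Fin k → ℝ)) :=
      (dotProductBilin ℝ ℝ (-Pi.single j 1)).coprod (dotProductBilin ℝ ℝ 0)
    refine dim_section_add_one (Q P h) φ 0
      ⟨(Pi.single i₀ 1 - Pi.single j 1, 0), ?_, ?_⟩ fun x hx hφ => ?_
    · rw [mem_vectorSpan_Q]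
      exact ⟨by simp, zero_mem _⟩
    · simp [φ, dotProductBilin, hi₀.symm]
    · rw [mem_vectorSpan_Q] at hx
      have hxj : x.1 j = 0 := by simpa [φ, dotProductBilin] using hφ
      refine mem_vectorSpan_of_vertices (T := face (Q P h) (-Pi.single j 1) 0 0)
        (fun i => hExt h i.val) (L h) {j}ᶜ ⟨i₀, hi₀⟩
        (fun i hi => single_mem_J_face h j i hi _ (single_hExt_mem_Q h i)) ?_ hx.1
        (fun i hi => by rw [Set.notMem_compl_iff.1 hi, hxj]) ?_
      · rw [← span_step_compl_of_mem_J h j hj]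
        exact zero_prod_mem_vectorSpan h _
          (fun i hi => single_mem_J_face h j i hi _ (single_hExt_mem_Q h i))
          (fun i hi => single_mem_J_face h j i hi _ (single_hExt_succ_mem_Q h i))
      · exact sub_mem hx.2 (sum_smul_hExt_mem_L h _ (fun j => ⟨_, rfl⟩) _ hx.1)

theorem single_mem_max_face (b : Fin k → ℝ) (j : Fin (n + 1)) (y : Fin k → ℝ)
    (hy : (Pi.single j 1, y) ∈ Q P h) (hb : b ⬝ᵥ y = maxCoef h b j) :
    (Pi.single j 1, y) ∈ face (Q P h) (-maxCoef h b) b 0 := by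
  refine ⟨hy, ?_⟩
  simp [hb]

/-- Each coordinate vector has a vertex above it on the face of the upper inequality. -/
theorem exists_vertex_max_face (b : Fin k → ℝ) (j : Fin (n + 1)) :
    ∃ w ∈ Set.range h, b ⬝ᵥ w = maxCoef h b j ∧
      (Pi.single j 1, w) ∈ face (Q P h) (-maxCoef h b) b 0 := by
  rcases max_choice (b ⬝ᵥ hExt h (j.val + 1)) (b ⬝ᵥ hExt h j.val) with h1 | h1
  · exact ⟨hExt h (j.val + 1), ⟨_, rfl⟩, h1.symm,
      single_mem_max_face h b j _ (single_hExt_succ_mem_Q h j) h1.symm⟩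
  · exact ⟨hExt h j.val, ⟨_, rfl⟩, h1.symm,
      single_mem_max_face h b j _ (single_hExt_mem_Q h j) h1.symm⟩

/-- Differences that span the hyperplane lie in it, so they are among the steps orthogonal to `b`.
-/
theorem mem_span_step_of_spannedHyperplane (b : Fin k → ℝ) (hS : M h b ∈ spannedHyperplanes h)
    {z : Fin k → ℝ} (hz : z ∈ L h) (hbz : b ⬝ᵥ z = 0) :
    z ∈ Submodule.span ℝ (step h '' {j | b ⬝ᵥ step h j = 0}) := by
  obtain ⟨-, I, hI⟩ := hS
  have hz' : z ∈ (Submodule.span ℝ (c h '' I) : Set (Fin k → ℝ)) := hI ▸ ⟨hz, hbz⟩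
  refine Submodule.span_mono ?_ hz'
  rintro _ ⟨i, hi, rfl⟩
  have hci : c h i ∈ M h b := by
    rw [hI]
    exact Submodule.subset_span ⟨i, hi, rfl⟩
  have hst := step_of_val_eq h i ⟨i.val + 1, by omega⟩ rfl
  exact ⟨⟨i.val + 1, by omega⟩, by simpa [hst] using hci.2, hst⟩

/-- The face contains a vertex above every `e_j`, and both of them when `b` is orthogonal to `step h
j`; those steps span the whole hyperplane `M h b`. -/
theorem isFacetDefining_max (b : Fin k → ℝ) (hbL : b ∈ L h) (hb0 : b ≠ 0)
    (hS : M h b ∈ spannedHyperplanes h) : IsFacetDefining (Q P h) (-maxCoef h b) b 0 := by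
  choose w hw hbw hwF using exists_vertex_max_face h b
  refine ⟨fun x hx => ?_, ⟨_, hwF 0⟩, ?_⟩
  · have : b ⬝ᵥ x.2 ≤ maxCoef h b ⬝ᵥ x.1 := maxCoef_valid h b hx
    rw [neg_dotProduct]
    linarith
  · let φ : Module.Dual ℝ ((Fin (n + 1) → ℝ) × (Fin k → ℝ)) :=
      (dotProductBilin ℝ ℝ (-maxCoef h b)).coprod (dotProductBilin ℝ ℝ b)
    refine dim_section_add_one (Q P h) φ 0 ⟨(0, b), ?_, ?_⟩ fun x hx hφ => ?_
    · rw [mem_vectorSpan_Q]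
      exact ⟨by simp, hbL⟩
    · simpa [φ, dotProductBilin] using hb0
    · rw [mem_vectorSpan_Q] at hx
      refine mem_vectorSpan_of_vertices (T := face (Q P h) (-maxCoef h b) b 0) w
        (Submodule.span ℝ (step h '' {j | b ⬝ᵥ step h j = 0})) Set.univ Set.univ_nonempty
        (fun j _ => hwF j) ?_ hx.1 (by simp) ?_
      · have heq : ∀ j ∈ {j | b ⬝ᵥ step h j = 0},
            b ⬝ᵥ hExt h (j.val + 1) = b ⬝ᵥ hExt h j.val := fun j hj => by
          have hj' : b ⬝ᵥ step h j = 0 := hj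
          rwa [step, dotProduct_sub, sub_eq_zero] at hj'
        exact zero_prod_mem_vectorSpan h _
          (fun j hj => single_mem_max_face h b j _ (single_hExt_mem_Q h j)
            (by rw [maxCoef, heq j hj, max_self]))
          (fun j hj => single_mem_max_face h b j _ (single_hExt_succ_mem_Q h j)
            (by rw [maxCoef, heq j hj, max_self]))
      -- The vertical remainder is orthogonal to `b` because `b · w j = maxCoef h b j` and `φ x =
      -- 0`.
      · refine mem_span_step_of_spannedHyperplane h b hS
          (sub_mem hx.2 (sum_smul_hExt_mem_L h w hw _ hx.1)) ?_
        have h1 : -maxCoef h b ⬝ᵥ x.1 + b ⬝ᵥ x.2 = 0 := hφ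
        rw [neg_dotProduct] at h1
        rw [dotProduct_sub, dotProduct_sum]
        simp only [dotProduct_smul, hbw, smul_eq_mul]
        have h2 : ∑ j, x.1 j * maxCoef h b j = maxCoef h b ⬝ᵥ x.1 :=
          Finset.sum_congr rfl fun j _ => mul_comm _ _
        linarith

theorem isFacetDefining_min (b : Fin k → ℝ) (hbL : b ∈ L h) (hb0 : b ≠ 0)
    (hS : M h b ∈ spannedHyperplanes h) : IsFacetDefining (Q P h) (minCoef h b) (-b) 0 := by
  have := isFacetDefining_max h (-b) (neg_mem hbL) (neg_ne_zero.2 hb0) (by rwa [M_neg])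
  rwa [maxCoef_neg, neg_neg] at this

/-- The face has a point above `e_j` and one above another `e_i`, which would force both `β = 1` and
`β = 0`. -/
theorem max_face_ne_bound (b : Fin k → ℝ) (j : Fin (n + 1)) (β : ℝ) :
    face (Q P h) (-maxCoef h b) b 0 ≠ {x | x ∈ Q P h ∧ x.1 j = β} := by
  intro heq
  obtain ⟨i, hi⟩ : ∃ i : Fin (n + 1), i ≠ j := by
    have := Nat.pos_of_neZero n
    have : Nontrivial (Fin (n + 1)) := Fin.nontrivial_iff_two_le.2 (by omega)
    exact exists_ne j
  obtain ⟨w, -, -, hw⟩ := exists_vertex_max_face h b j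
  obtain ⟨w', -, -, hw'⟩ := exists_vertex_max_face h b i
  rw [heq] at hw hw'
  have h1 := hw.2
  have h2 := hw'.2
  simp [hi.symm] at h1 h2
  linarith

theorem min_face_ne_bound (b : Fin k → ℝ) (j : Fin (n + 1)) (β : ℝ) :
    face (Q P h) (minCoef h b) (-b) 0 ≠ {x | x ∈ Q P h ∧ x.1 j = β} := by
  have := max_face_ne_bound h (-b) j β
  rwa [maxCoef_neg, neg_neg] at this

end SOS2

/-! ### Sufficiency of the inequalities. -/

namespace SOS2
open Matrix

variable {n k : ℕ}

/-- The component of `b` orthogonal to `b'` lies in the common hyperplane, so it is orthogonal to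
both vectors and hence to itself. -/
theorem exists_smul_eq_of_M_eq (h : Fin n → Fin k → ℝ) {b b' : Fin k → ℝ} (hb : b ∈ L h)
    (hb' : b' ∈ L h) (hb0 : b' ≠ 0) (hM : M h b' = M h b) : ∃ α : ℝ, b = α • b' := by
  have h0 : b' ⬝ᵥ b' ≠ 0 := fun h1 => hb0 (dotProduct_self_eq_zero.1 h1)
  let α := (b' ⬝ᵥ b) / (b' ⬝ᵥ b')
  have h1 : b' ⬝ᵥ (b - α • b') = 0 := by
    rw [dotProduct_sub, dotProduct_smul, smul_eq_mul, div_mul_cancel₀ _ h0, sub_self]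
  have h2 : b - α • b' ∈ M h b' := ⟨sub_mem hb (Submodule.smul_mem _ _ hb'), h1⟩
  rw [hM] at h2
  have h3 : (b - α • b') ⬝ᵥ (b - α • b') = 0 := by
    rw [sub_dotProduct, smul_dotProduct, h1, h2.2]
    simp
  exact ⟨α, sub_eq_zero.1 (dotProduct_self_eq_zero.1 h3)⟩

variable [NeZero n] (h : Fin n → Fin k → ℝ)

/-- If leaving out a difference lowers the dimension, the other differences span a hyperplane, and
the two inequalities of that hyperplane together are a multiple of `0 ≤ lam j`. -/
theorem nonneg_of_notMem_J {N : ℕ} (b : Fin N → Fin k → ℝ)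
    (hM : Set.range (fun l => M h (b l)) = spannedHyperplanes h) {lam : Fin (n + 1) → ℝ}
    (hlam : ∀ l, ∑ j, minCoef h (b l) j * lam j ≤ ∑ j, maxCoef h (b l) j * lam j)
    (j : Fin (n + 1)) (hj : j ∉ J h) : 0 ≤ lam j := by
  set W := Submodule.span ℝ (step h '' {j}ᶜ) with hW
  have hWL : W ≤ L h := step_image_span_le h _
  have hstep : step h j ∉ W := by
    intro hmem
    refine hj (Or.inr ⟨fun h0 => hj (Or.inl (Or.inl h0)), fun h0 => hj (Or.inl (Or.inr h0)), ?_⟩)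
    rw [← span_step_compl]
    refine le_antisymm ?_ hWL
    rw [← span_step, Submodule.span_le]
    rintro _ ⟨i, rfl⟩
    by_cases hi : i = j
    · rw [hi]
      exact hmem
    · exact Submodule.subset_span ⟨i, hi, rfl⟩
  obtain ⟨g, hg, hgW⟩ := Submodule.exists_le_ker_of_notMem hstep
  obtain ⟨d, hdL, hd⟩ := exists_dotProduct_eq (L h) (g.domRestrict (L h))
  have hdg : ∀ y ∈ L h, d ⬝ᵥ y = g y := fun y hy => (hd ⟨y, hy⟩).symm
  have hdj : d ⬝ᵥ step h j ≠ 0 := by rwa [hdg _ (step_mem_L h j)]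
  have hMd : M h d = W := by
    ext y
    refine ⟨fun hy => ?_, fun hy => ⟨hWL hy, (hdg y (hWL hy)).trans (hgW hy)⟩⟩
    have hyL : y ∈ Submodule.span ℝ (insert (step h j) (step h '' {j}ᶜ)) := by
      rw [← Set.image_insert_eq, Set.insert_eq, Set.union_compl_self, Set.image_univ, span_step]
      exact hy.1
    obtain ⟨a, z, hz, rfl⟩ := Submodule.mem_span_insert.1 hyL
    have h1 : d ⬝ᵥ z = 0 := (hdg z (hWL hz)).trans (hgW hz)
    have h2 := hy.2
    rw [dotProduct_add, h1, add_zero, dotProduct_smul, smul_eq_mul, mul_eq_zero] at h2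
    rw [h2.resolve_right hdj, zero_smul, zero_add]
    exact hz
  have hsp : M h d ∈ spannedHyperplanes h :=
    ⟨⟨d, hdL, fun h0 => hdj (by rw [h0, zero_dotProduct]), rfl⟩,
      _, by rw [hMd, hW, span_step_compl]⟩
  rw [← hM] at hsp
  obtain ⟨l, hl⟩ := hsp
  have hl' : M h (b l) = W := Eq.trans hl hMd
  have hzero : ∀ i, i ≠ j → b l ⬝ᵥ step h i = 0 := fun i hi => by
    have : step h i ∈ M h (b l) := by
      rw [hl']
      exact Submodule.subset_span ⟨i, hi, rfl⟩
    exact this.2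
  have hne : b l ⬝ᵥ step h j ≠ 0 := fun h0 => by
    have : step h j ∈ M h (b l) := ⟨step_mem_L h j, h0⟩
    rw [hl'] at this
    exact hstep this
  -- Upper minus lower bound is `∑ |b l · step i| lam i`, in which only the term `i = j` survives.
  have hsub : ∀ i, (maxCoef h (b l) i - minCoef h (b l) i) = |b l ⬝ᵥ step h i| := fun i => by
    rw [maxCoef, minCoef, max_sub_min_eq_abs', step, dotProduct_sub]
  have h1 := sub_nonneg.2 (hlam l)
  rw [← Finset.sum_sub_distrib] at h1
  simp only [← sub_mul, hsub] at h1
  rw [Finset.sum_eq_single j (fun i _ hi => by simp [hzero i hi]) (by simp)] at h1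
  exact nonneg_of_mul_nonneg_right h1 (abs_pos.2 hne)

/-- The normal `d` is a multiple of some `b l`; a nonnegative factor scales the upper inequality, a
nonpositive one reverses the lower inequality into it. -/
theorem le_maxCoef_of_spanned {N : ℕ} (b : Fin N → Fin k → ℝ) (hb : ∀ l, b l ∈ L h ∧ b l ≠ 0)
    (hM : Set.range (fun l => M h (b l)) = spannedHyperplanes h) {lam : Fin (n + 1) → ℝ}
    {y : Fin k → ℝ}
    (hy : ∀ l, ∑ j, minCoef h (b l) j * lam j ≤ b l ⬝ᵥ y ∧
      b l ⬝ᵥ y ≤ ∑ j, maxCoef h (b l) j * lam j)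
    (d : Fin k → ℝ) (hdL : d ∈ L h) (hS : M h d ∈ spannedHyperplanes h) :
    d ⬝ᵥ y ≤ ∑ j, maxCoef h d j * lam j := by
  rw [← hM] at hS
  obtain ⟨l, hl⟩ := hS
  obtain ⟨α, rfl⟩ := exists_smul_eq_of_M_eq h hdL (hb l).1 (hb l).2 hl
  rw [smul_dotProduct, smul_eq_mul]
  rcases le_total 0 α with hα | hα
  · have h1 : maxCoef h (α • b l) = α • maxCoef h (b l) := by
      ext j
      simp [maxCoef, mul_max_of_nonneg _ _ hα]
    refine (mul_le_mul_of_nonneg_left (hy l).2 hα).trans_eq ?_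
    rw [h1, Finset.mul_sum]
    simp [mul_assoc]
  · have h1 : maxCoef h (α • b l) = α • minCoef h (b l) := by
      ext j
      simp only [maxCoef, minCoef, smul_dotProduct, smul_eq_mul, Pi.smul_apply]
      exact ((antitone_mul_left hα).map_min).symm
    refine (mul_le_mul_of_nonpos_left (hy l).1 hα).trans_eq ?_
    rw [h1, Finset.mul_sum]
    simp [mul_assoc]

/-- The zonotope description is applied inside `L h` to `y - p`. All steps count as generators
there, even those of weight zero, so the list of normals is the same for every `lam`. -/
theorem mem_Q_of_le_maxCoef {lam : Fin (n + 1) → ℝ} {y : Fin k → ℝ} (hlam : ∀ j, 0 ≤ lam j)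
    (hsum : ∑ j, lam j = 1) (hyL : y ∈ affineSpan ℝ (Set.range h))
    (hy : ∀ d ∈ L h, M h d ∈ spannedHyperplanes h → d ⬝ᵥ y ≤ ∑ j, maxCoef h d j * lam j) :
    (lam, y) ∈ Q P h := by
  set p := ∑ j, lam j • hExt h j.val with hp
  have hpL : p ∈ affineSpan ℝ (Set.range h) :=
    (affineSpan ℝ (Set.range h)).convex.sum_mem (fun j _ => hlam j) hsum
      fun j _ => mem_affineSpan ℝ ⟨_, rfl⟩
  have hypL : y - p ∈ L h := AffineSubspace.vsub_mem_direction hyL hpL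
  let v : Fin (n + 1) → L h := fun j => ⟨step h j, step_mem_L h j⟩
  have himage : ∀ A, (Submodule.span ℝ (v '' A)).map (L h).subtype =
      Submodule.span ℝ (step h '' A) := fun A => by
    rw [Submodule.map_span, ← Set.image_comp]
    rfl
  have hv : Submodule.span ℝ (Set.range v) = ⊤ := by
    apply Submodule.map_injective_of_injective (L h).injective_subtype
    rw [← Set.image_univ, himage, Set.image_univ, span_step, Submodule.map_top,
      Submodule.range_subtype]
  have hsep : ∀ g : Module.Dual ℝ (L h),
      LinearMap.ker g = Submodule.span ℝ (v '' {i | g (v i) = 0}) →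
      g ⟨y - p, hypL⟩ ≤ ∑ i, lam i * max (g (v i)) 0 := by
    intro g hg
    obtain ⟨d, hdL, hd⟩ := exists_dotProduct_eq (L h) g
    -- The zero functional may satisfy the kernel condition but defines no hyperplane; its
    -- inequality is trivial.
    by_cases hd0 : d = 0
    · simp [hd, hd0]
    have hMd : M h d = Submodule.span ℝ (step h '' {j | g (v j) = 0}) := by
      rw [← himage, ← hg]
      ext z
      constructor
      · exact fun hz => ⟨⟨z, hz.1⟩, (hd _).trans hz.2, rfl⟩
      · rintro ⟨z, hz, rfl⟩
        exact ⟨z.2, (hd z).symm.trans hz⟩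
    have h1 := hy d hdL ⟨⟨d, hdL, hd0, rfl⟩, _, by rw [hMd, span_step_image]⟩
    have h2 : ∀ j, lam j * max (g (v j)) 0 =
        maxCoef h d j * lam j - lam j * (d ⬝ᵥ hExt h j.val) := fun j => by
      rw [hd, ← maxCoef_sub]
      ring
    rw [Finset.sum_congr rfl fun j _ => h2 j, Finset.sum_sub_distrib, hd]
    have h3 : d ⬝ᵥ p = ∑ j, lam j * (d ⬝ᵥ hExt h j.val) := by
      simp [hp, dotProduct_sum]
    simp only [dotProduct_sub, h3]
    linarith
  obtain ⟨s, hs0, hs1, hs⟩ := exists_zonotope_coeff v hv lam hlam ⟨y - p, hypL⟩ hsep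
  have hs' : ∑ j, s j • step h j = y - p := by
    have := congrArg (L h).subtype hs
    simpa [map_sum, v] using this
  have := mem_Q_of_coeff h lam s hsum hs0 hs1
  rwa [hs', ← hp, add_sub_cancel] at this

end SOS2

open SOS2 Matrix in
theorem proposition3 {n k : ℕ} [NeZero n] (h : Fin n → Fin k → ℝ) (hh : IsEncoding h)
    {N : ℕ} (b : Fin N → Fin k → ℝ) (hb : ∀ l, b l ∈ L h ∧ b l ≠ 0)
    (hM : Set.range (fun l => M h (b l)) = spannedHyperplanes h) :
    -- the description of `Q`
    (∀ (lam : Fin (n + 1) → ℝ) (y : Fin k → ℝ), (lam, y) ∈ Q P h ↔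
      (∑ j, lam j = 1 ∧ y ∈ affineSpan ℝ (Set.range h)) ∧
      (∀ l, ∑ j, minCoef h (b l) j * lam j ≤ b l ⬝ᵥ y ∧
        b l ⬝ᵥ y ≤ ∑ j, maxCoef h (b l) j * lam j) ∧
      (∀ j ∈ J h, 0 ≤ lam j)) ∧
    -- the dimension and the affine hull of `Q`
    dim (Q P h) = n + dim (Set.range h) ∧
    (∀ (lam : Fin (n + 1) → ℝ) (y : Fin k → ℝ), (lam, y) ∈ affineSpan ℝ (Q P h) ↔
      ∑ j, lam j = 1 ∧ y ∈ affineSpan ℝ (Set.range h)) ∧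
    -- all the inequalities are facet defining
    (∀ l, IsFacetDefining (Q P h) (minCoef h (b l)) (-b l) 0 ∧
      IsFacetDefining (Q P h) (-maxCoef h (b l)) (b l) 0) ∧
    (∀ j ∈ J h, IsFacetDefining (Q P h) (-Pi.single j 1) 0 0) ∧
    -- no bound `lam j ≥ β` or `lam j ≤ β` defines the facet of a general inequality
    (∀ l (j : Fin (n + 1)) (β : ℝ),
      face (Q P h) (minCoef h (b l)) (-b l) 0 ≠ {x | x ∈ Q P h ∧ x.1 j = β} ∧
      face (Q P h) (-maxCoef h (b l)) (b l) 0 ≠ {x | x ∈ Q P h ∧ x.1 j = β}) := by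
  have hS : ∀ l, M h (b l) ∈ spannedHyperplanes h := fun l => hM ▸ Set.mem_range_self l
  refine ⟨fun lam y => ⟨fun hx => ?_, ?_⟩, dim_Q h, mem_affineSpan_Q h,
    fun l => ⟨isFacetDefining_min h (b l) (hb l).1 (hb l).2 (hS l),
      isFacetDefining_max h (b l) (hb l).1 (hb l).2 (hS l)⟩,
    isFacetDefining_of_mem_J h,
    fun l j β => ⟨min_face_ne_bound h (b l) j β, max_face_ne_bound h (b l) j β⟩⟩
  · exact ⟨⟨sum_eq_one_of_mem_Q h hx, snd_mem_of_mem_Q h hx⟩,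
      fun l => ⟨minCoef_valid h (b l) hx, maxCoef_valid h (b l) hx⟩,
      fun j _ => nonneg_of_mem_Q h hx j⟩
  · rintro ⟨⟨hsum, hyL⟩, hy, hJ⟩
    refine mem_Q_of_le_maxCoef h (fun j => ?_) hsum hyL
      (le_maxCoef_of_spanned h b hb hM hy)
    by_cases hj : j ∈ J h
    · exact hJ j hj
    · exact nonneg_of_notMem_J h b hM (fun l => (hy l).1.trans (hy l).2) j hj
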